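/- Let $\beta^0$ be the indicator function of $[0,1)$ and let $\beta^{n+1}=\beta^0*\beta^n$ be the causal polynomial B-splines, so that $\beta^2$ and $\beta^3$ are the quadratic and cubic B-splines, supported in $[0,3]$ and $[0,4]$. Let $\varphi_1,\varphi_2\in L_2(\mathbb{R})$ be (possibly complex-valued) functions, and let $a,b,c,d:\mathbb{Z}\to\mathbb{C}$ be sequences with $$\sum_{k\in\mathbb{Z}}|k|^3\bigl(|a_k|+|b_k|+|c_k|+|d_k|\bigr)<\infty$$ such that, for almost every $t\in\mathbb{R}$, $$\beta^2(t)=\sum_{k\in\mathbb{Z}}\bigl(a_k\varphi_1(t-k)+b_k\varphi_2(t-k)\bigr),\qquad \beta^3(t)=\sum_{k\in\mathbb{Z}}\bigl(c_k\varphi_1(t-k)+d_k\varphi_2(t-k)\bigr).$$ Then $\beta^2$ and $\beta^3$ belong to $$V(\varphi_1,\varphi_2)=\Bigl\{\sum_{i=1}^{2}\sum_{k\in\mathbb{Z}}c_i[k]\,\varphi_i(\cdot-k)\ (\text{convergent in }L_2)\;:\;c_1,c_2\in\ell_2(\mathbb{Z})\Bigr\},$$ and $$|\mathrm{Supp}\,\varphi_1|+|\mathrm{Supp}\,\varphi_2|\ge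 4,$$ where $\mathrm{Supp}\,\varphi$ is the essential support of $\varphi$ (the complement of the largest open set on which $\varphi=0$ almost everywhere) and $|\cdot|$ is Lebesgue measure, with values in $[0,\infty]$. -/

import Mathlib

open MeasureTheory Filter Topology

noncomputable section

/-- The (causal) polynomial B-spline `β^n` of degree `n`, i.e. of order `n + 1`: `β^0` is the
indicator function of `[0, 1)`, and `β^(n+1) = β^0 * β^n` (convolution). Its Fourier transform is
`ω ↦ ((1 - exp (-jω)) / (jω)) ^ (n + 1)`, and it is supported in `[0, n + 1]`. -/
def bspline : ℕ → ℝ → ℝ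
  | 0 => Set.indicator (Set.Ico 0 1) (fun _ => 1)
  | n + 1 => MeasureTheory.convolution (Set.indicator (Set.Ico 0 1) (fun _ => 1)) (bspline n)
      (ContinuousLinearMap.mul ℝ ℝ) volume

/-- The (essential, closed) support of a function defined up to null sets: the complement of the
largest open set on which `f` vanishes almost everywhere. -/
def essSupport (f : ℝ → ℂ) : Set ℝ :=
  {x | ∀ U ∈ 𝓝 x, ¬ (∀ᵐ t ∂(volume.restrict U), f t = 0)}

/-- The shift-invariant space `V(φ_1, …, φ_N)`: the `L²` functions that are sums, in the sense of
`L²` convergence, of `∑ i, ∑ k, c_i[k] φ_i(· - k)` with square-summable coefficient sequences. -/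
def shiftInvariantSpace {N : ℕ} (φ : Fin N → ℝ → ℂ) : Set (ℝ → ℂ) :=
  {f | MemLp f 2 volume ∧ ∃ c : Fin N → ℤ → ℂ,
    (∀ i, Summable fun k : ℤ => ‖c i k‖ ^ 2) ∧
    Tendsto (fun s : Finset ℤ =>
        eLpNorm (fun t => f t - ∑ i, ∑ k ∈ s, c i k * φ i (t - k)) 2 volume)
      atTop (𝓝 0)}

end

/-! Fix `t ∈ [0, 1)`. The four values `β³(t + n)`, `n = 0, …, 3`, are combinations of the numbers
`φ₁(t + m)` and `φ₂(t + m)`, with coefficients `c (n - m)` and `d (n - m)` that do not depend on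
`t`. If fewer than four of these numbers can be nonzero, some `w ≠ 0` cancels every coefficient
involved, so `∑ w n * β³(t + n) = 0`. The four pieces of `β³` are linearly independent cubics, so a
given choice of active shifts `S`, `T` allows only finitely many `t`
(`finite_of_bspline_three_expansion`). There are countably many choices; hence almost every `t` has
at least four translates in the two supports, and integrating this count over `[0, 1)` bounds the
measures (`le_volume_add_volume_of_encard`). Membership in `V` is separate: the weighted summability
makes the expansions absolutely convergent in `L²`. -/

/-! ### B-splines and truncated powers -/

/-- The truncated power `t₊ ^ n / n!`. -/
noncomputable def truncPow (n : ℕ) (t : ℝ) : ℝ := if 0 ≤ t then t ^ n / n.factorial else 0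

theorem truncPow_of_nonneg (n : ℕ) {t : ℝ} (ht : 0 ≤ t) :
    truncPow n t = t ^ n / n.factorial := if_pos ht

theorem truncPow_of_neg (n : ℕ) {t : ℝ} (ht : t < 0) : truncPow n t = 0 := if_neg ht.not_ge

theorem truncPow_succ_eq_max (n : ℕ) (t : ℝ) :
    truncPow (n + 1) t = max t 0 ^ (n + 1) / (n + 1).factorial := by
  rcases lt_or_ge t 0 with h | h
  · simp [truncPow_of_neg _ h, max_eq_right h.le]
  · rw [truncPow_of_nonneg _ h, max_eq_left h]

theorem continuous_truncPow_succ (n : ℕ) : Continuous (truncPow (n + 1)) := by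
  rw [funext (truncPow_succ_eq_max n)]
  fun_prop

theorem monotone_truncPow (n : ℕ) : Monotone (truncPow n) := by
  intro s t h
  unfold truncPow
  split_ifs with h1 h2
  · gcongr
  · exact absurd (h1.trans h) h2
  · positivity
  · exact le_rfl

theorem hasDerivAt_truncPow_succ (n : ℕ) {t : ℝ} (ht : t ≠ 0) :
    HasDerivAt (truncPow (n + 1)) (truncPow n t) t := by
  rcases ht.lt_or_gt with h | h
  · rw [truncPow_of_neg _ h]
    refine (hasDerivAt_const t (0 : ℝ)).congr_of_eventuallyEq ?_
    filter_upwards [gt_mem_nhds h] with s hs using truncPow_of_neg _ hs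
  · rw [truncPow_of_nonneg _ h.le]
    have hd := (hasDerivAt_pow (n + 1) t).div_const ((n + 1).factorial : ℝ)
    refine (hd.congr_deriv ?_).congr_of_eventuallyEq ?_
    · rw [Nat.factorial_succ]
      push_cast
      have := n.factorial_pos
      field_simp
    · filter_upwards [lt_mem_nhds h] with s hs using truncPow_of_nonneg _ (le_of_lt hs)

/-- The fundamental theorem of calculus may skip the point `0`, where `truncPow 0` jumps and
`truncPow 1` has a corner. -/
theorem integral_truncPow (n : ℕ) (x y : ℝ) :
    ∫ t in x..y, truncPow n t = truncPow (n + 1) y - truncPow (n + 1) x :=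
  integral_eq_of_hasDerivAt_off_countable _ _ (Set.countable_singleton (0 : ℝ))
    (continuous_truncPow_succ n).continuousOn
    (fun _ ht => hasDerivAt_truncPow_succ n ht.2) (monotone_truncPow n).intervalIntegrable

theorem intervalIntegrable_truncPow_sub (n : ℕ) (j x y : ℝ) :
    IntervalIntegrable (fun t => truncPow n (t - j)) volume x y :=
  ((monotone_truncPow n).comp fun _ _ h => sub_le_sub_right h j).intervalIntegrable

theorem integral_truncPow_sub (n : ℕ) (j x : ℝ) :
    ∫ t in (x - 1)..x, truncPow n (t - j) =
      truncPow (n + 1) (x - j) - truncPow (n + 1) (x - (j + 1)) := by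
  rw [intervalIntegral.integral_comp_sub_right (truncPow n), integral_truncPow]
  ring_nf

theorem bspline_succ_eq_integral (n : ℕ) (x : ℝ) :
    bspline (n + 1) x = ∫ t in (x - 1)..x, bspline n t := by
  rw [bspline, convolution_def]
  have h : ∀ t : ℝ, (ContinuousLinearMap.mul ℝ ℝ)
      ((Set.Ico (0 : ℝ) 1).indicator (fun _ => (1 : ℝ)) t) (bspline n (x - t)) =
      (Set.Ico (0 : ℝ) 1).indicator (fun t => bspline n (x - t)) t := by
    intro t
    by_cases ht : t ∈ Set.Ico (0 : ℝ) 1 <;> simp [ht]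
  simp_rw [h]
  rw [integral_indicator measurableSet_Ico, integral_Ico_eq_integral_Ioc,
    ← intervalIntegral.integral_of_le zero_le_one,
    intervalIntegral.integral_comp_sub_left (bspline n), sub_zero]

/-- B-splines are alternating binomial sums of shifted truncated powers. -/
theorem bspline_eq_sum_truncPow (n : ℕ) (x : ℝ) :
    bspline n x = ∑ j ∈ Finset.range (n + 2),
      (-1) ^ j * ((n + 1).choose j : ℝ) * truncPow n (x - j) := by
  induction n generalizing x with
  | zero =>
    rw [bspline, Set.indicator_apply]
    simp only [Finset.sum_range_succ, Finset.sum_range_zero, truncPow, Set.mem_Ico]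
    by_cases h0 : 0 ≤ x <;> by_cases h1 : x < 1
    · simp [h0, h1]
    · simp [h0, h1, not_lt.1 h1]
    · simp [h0, h1]
    · linarith
  | succ n ih =>
    rw [bspline_succ_eq_integral]
    simp_rw [ih]
    rw [intervalIntegral.integral_finsetSum (f := fun (j : ℕ) (t : ℝ) =>
      (-1) ^ j * ((n + 1).choose j : ℝ) * truncPow n (t - j)) fun j _ =>
      (intervalIntegrable_truncPow_sub n j _ _).const_mul _]
    simp_rw [intervalIntegral.integral_const_mul, integral_truncPow_sub, mul_sub]
    rw [Finset.sum_sub_distrib, Finset.sum_range_succ' _ (n + 2),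
      Finset.sum_range_succ' _ (n + 1)]
    -- The extra term has binomial coefficient `(n + 1).choose (n + 2) = 0`; with equal ranges,
    -- Pascal's rule applies term by term.
    have hlast : ∑ j ∈ Finset.range (n + 2), (-1) ^ (j + 1) * ((n + 1).choose (j + 1) : ℝ) *
          truncPow (n + 1) (x - (j + 1 : ℕ)) =
        ∑ j ∈ Finset.range (n + 1), (-1) ^ (j + 1) * ((n + 1).choose (j + 1) : ℝ) *
          truncPow (n + 1) (x - (j + 1 : ℕ)) := by
      rw [Finset.sum_range_succ]
      simp
    rw [← hlast, add_sub_right_comm, ← Finset.sum_sub_distrib]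
    congr 1
    refine Finset.sum_congr rfl fun j _ => ?_
    rw [Nat.choose_succ_succ (n + 1) j]
    push_cast
    ring

/-! ### Linear independence of the cubic pieces -/

/-- The polynomial pieces of the cubic B-spline. -/
theorem bspline_three_piece {t : ℝ} (ht : t ∈ Set.Ico (0 : ℝ) 1) :
    bspline 3 t = t ^ 3 / 6 ∧
    bspline 3 (t + 1) = ((t + 1) ^ 3 - 4 * t ^ 3) / 6 ∧
    bspline 3 (t + 2) = ((t + 2) ^ 3 - 4 * (t + 1) ^ 3 + 6 * t ^ 3) / 6 ∧
    bspline 3 (t + 3) = ((t + 3) ^ 3 - 4 * (t + 2) ^ 3 + 6 * (t + 1) ^ 3 - 4 * t ^ 3) / 6 := by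
  obtain ⟨h0, h1⟩ := ht
  have hp : ∀ s : ℝ, 0 ≤ s → truncPow 3 s = s ^ 3 / 6 := fun s hs => by
    rw [truncPow_of_nonneg _ hs]; norm_num [Nat.factorial]
  have hn : ∀ s : ℝ, s < 0 → truncPow 3 s = 0 := fun s hs => truncPow_of_neg _ hs
  simp only [bspline_eq_sum_truncPow, Finset.sum_range_succ, Finset.sum_range_zero]
  norm_num [Nat.choose]
  refine ⟨?_, ?_, ?_, ?_⟩
  · rw [hp t h0, hn (t - 1) (by linarith), hn (t - 2) (by linarith), hn (t - 3) (by linarith),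
      hn (t - 4) (by linarith)]
    ring
  · rw [hp (t + 1) (by linarith), hp t (by linarith), hn (t + 1 - 2) (by linarith),
      hn (t + 1 - 3) (by linarith), hn (t + 1 - 4) (by linarith)]
    ring
  · rw [hp (t + 2) (by linarith), hp (t + 2 - 1) (by linarith), hp t (by linarith),
      hn (t + 2 - 3) (by linarith), hn (t + 2 - 4) (by linarith)]
    ring
  · rw [hp (t + 3) (by linarith), hp (t + 3 - 1) (by linarith), hp (t + 3 - 2) (by linarith),
      hp t (by linarith), hn (t + 3 - 4) (by linarith)]
    ring

/-- The four polynomial pieces of the cubic B-spline are linearly independent on every infinite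
subset of `[0, 1)`. -/
theorem bspline_three_shifts_linearIndependent {E : Set ℝ} (hE : E ⊆ Set.Ico 0 1)
    (hinf : E.Infinite) {w : Fin 4 → ℂ}
    (hw : ∀ t ∈ E, ∑ n : Fin 4, w n * (bspline 3 (t + (n : ℕ)) : ℂ) = 0) : w = 0 := by
  open Polynomial in
  set p : ℂ[X] := C (w 0) * X ^ 3 + C (w 1) * ((X + 1) ^ 3 - 4 * X ^ 3) +
    C (w 2) * ((X + 2) ^ 3 - 4 * (X + 1) ^ 3 + 6 * X ^ 3) +
    C (w 3) * ((X + 3) ^ 3 - 4 * (X + 2) ^ 3 + 6 * (X + 1) ^ 3 - 4 * X ^ 3) with hp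
  have hp0 : p = 0 := by
    refine Polynomial.eq_zero_of_infinite_isRoot p
      ((hinf.image Complex.ofReal_injective.injOn).mono ?_)
    rintro _ ⟨t, ht, rfl⟩
    have h := hw t ht
    obtain ⟨h0, h1, h2, h3⟩ := bspline_three_piece (hE ht)
    simp only [Fin.sum_univ_four, Fin.val_zero, Fin.val_one, Fin.val_two, Nat.cast_zero, add_zero,
      Nat.cast_one, Nat.cast_ofNat, show ((3 : Fin 4) : ℕ) = 3 from rfl, h0, h1, h2, h3] at h
    push_cast at h
    simp only [Set.mem_ofPred_eq, Polynomial.IsRoot, hp, Polynomial.eval_add, Polynomial.eval_mul,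
      Polynomial.eval_sub, Polynomial.eval_pow, Polynomial.eval_C, Polynomial.eval_X,
      Polynomial.eval_one, Polynomial.eval_ofNat]
    linear_combination 6 * h
  have he : ∀ z : ℂ, w 0 * z ^ 3 + w 1 * ((z + 1) ^ 3 - 4 * z ^ 3) +
      w 2 * ((z + 2) ^ 3 - 4 * (z + 1) ^ 3 + 6 * z ^ 3) +
      w 3 * ((z + 3) ^ 3 - 4 * (z + 2) ^ 3 + 6 * (z + 1) ^ 3 - 4 * z ^ 3) = 0 := by
    intro z
    have := congrArg (Polynomial.eval z) hp0
    simpa [hp] using this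
  -- Four values determine a cubic; the coefficients below invert the resulting 4 × 4 system for
  -- `w`.
  have e0 := he 0
  have e1 := he 1
  have e2 := he (-1)
  have e3 := he 2
  ext n
  fin_cases n <;> simp only [Fin.zero_eta, Fin.mk_one, Fin.reduceFinMk, Pi.zero_apply]
  · linear_combination (-1/9) * e0 + (5/36) * e1 + (1/36) * e2 + (1/9) * e3
  · linear_combination (-1/36) * e0 + (2/9) * e1 + (0) * e2 + (-1/36) * e3
  · linear_combination (2/9) * e0 + (-1/36) * e1 + (-1/36) * e2 + (0) * e3
  · linear_combination (5/36) * e0 + (-1/9) * e1 + (1/9) * e2 + (1/36) * e3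

/-! ### Essential supports -/

theorem isOpen_compl_essSupport (f : ℝ → ℂ) : IsOpen (essSupport f)ᶜ := by
  refine isOpen_iff_mem_nhds.2 fun x hx => ?_
  simp only [essSupport, Set.mem_compl_iff, Set.mem_ofPred_eq, not_forall, not_not] at hx
  obtain ⟨U, hU, h⟩ := hx
  filter_upwards [eventually_mem_nhds_iff.2 hU] with y hy hmem using hmem U hy h

theorem measurableSet_essSupport (f : ℝ → ℂ) : MeasurableSet (essSupport f) :=
  (isOpen_compl_essSupport f).measurableSet.of_compl

/-- A function vanishes almost everywhere outside its essential support. -/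
theorem ae_mem_essSupport_of_ne_zero (f : ℝ → ℂ) :
    ∀ᵐ t : ℝ, f t ≠ 0 → t ∈ essSupport f := by
  have h : volume {t | t ∉ essSupport f ∧ f t ≠ 0} = 0 := by
    refine measure_null_of_locally_null _ fun x hx => ?_
    have hx' := hx.1
    simp only [essSupport, Set.mem_ofPred_eq, not_forall, not_not] at hx'
    obtain ⟨U, hU, h⟩ := hx'
    obtain ⟨V, hVU, hV, hxV⟩ := mem_nhds_iff.1 hU
    refine ⟨_, inter_mem_nhdsWithin _ (hV.mem_nhds hxV), ?_⟩
    have h0 := (ae_restrict_iff' hV.measurableSet).1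
      (ae_mono (Measure.restrict_mono hVU le_rfl) h)
    refine measure_mono_null ?_ (ae_iff.1 h0)
    rintro t ⟨⟨-, ht⟩, htV⟩ hcon
    exact ht (hcon htV)
  refine measure_mono_null ?_ h
  intro t ht
  simpa [and_comm] using ht

/-! ### Counting integer translates -/

/-- If `P` holds almost everywhere on `ℝ`, then almost every `t` satisfies `P` at all its integer
translates. -/
theorem ae_forall_add_int {P : ℝ → Prop} (h : ∀ᵐ t : ℝ, P t) : ∀ᵐ t : ℝ, ∀ k : ℤ, P (t + k) :=
  ae_all_iff.2 fun k => (measurePreserving_add_right volume (k : ℝ)).quasiMeasurePreserving.ae h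

/-- The average over `t ∈ [0, 1)` of the number of integer translates of `t` lying in `A` is at most `|A|`. -/
theorem lintegral_encard_int_translates_le {A : Set ℝ} (hA : MeasurableSet A) :
    ∫⁻ t in Set.Ico (0 : ℝ) 1, ∑' k : ℤ, A.indicator (fun _ => (1 : ENNReal)) (t + k) ≤
      volume A := by
  have hm : ∀ k : ℤ, Measurable fun t : ℝ => A.indicator (fun _ => (1 : ENNReal)) (t + k) :=
    fun k => (measurable_const.indicator hA).comp (measurable_add_const _)
  rw [lintegral_tsum fun k => (hm k).aemeasurable]
  have hk : ∀ k : ℤ, ∫⁻ t in Set.Ico (0 : ℝ) 1, A.indicator (fun _ => (1 : ENNReal)) (t + k) =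
      volume (A ∩ Set.Ico (k : ℝ) (k + 1)) := by
    intro k
    have hmp := measurePreserving_add_right volume (k : ℝ)
    have hpre : (fun t : ℝ => t + k) ⁻¹' Set.Ico (k : ℝ) (k + 1) = Set.Ico 0 1 := by
      ext t
      simp only [Set.mem_preimage, Set.mem_Ico]
      constructor <;> rintro ⟨h1, h2⟩ <;> constructor <;> linarith
    rw [← hpre, hmp.setLIntegral_comp_preimage measurableSet_Ico (measurable_const.indicator hA),
      lintegral_indicator hA, lintegral_const, one_mul, Measure.restrict_restrict hA,
      Measure.restrict_apply_univ]
  simp_rw [hk]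
  rw [← measure_iUnion (fun i j hij => ((Set.pairwise_disjoint_Ico_intCast ℝ) hij).mono
    Set.inter_subset_right Set.inter_subset_right) fun k => hA.inter measurableSet_Ico]
  exact measure_mono (Set.iUnion_subset fun k => Set.inter_subset_left)

theorem tsum_indicator_int_translates (A : Set ℝ) (t : ℝ) :
    ∑' k : ℤ, A.indicator (fun _ => (1 : ENNReal)) (t + k) =
      ({k : ℤ | t + k ∈ A}.encard : ENNReal) := by
  rw [← ENNReal.tsum_set_one, tsum_subtype _ fun _ => (1 : ENNReal)]
  rfl

/-- If almost every `t ∈ [0, 1)` has at least `N` integer translates in `A` and `B`, counted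
together, then `N ≤ |A| + |B|`. -/
theorem le_volume_add_volume_of_encard {A B : Set ℝ} (hA : MeasurableSet A)
    (hB : MeasurableSet B) {N : ENNReal}
    (h : ∀ᵐ t : ℝ, t ∈ Set.Ico (0 : ℝ) 1 →
      N ≤ ({k : ℤ | t + k ∈ A}.encard : ENNReal) + ({k : ℤ | t + k ∈ B}.encard : ENNReal)) :
    N ≤ volume A + volume B := by
  refine le_trans ?_ (add_le_add (lintegral_encard_int_translates_le hA)
    (lintegral_encard_int_translates_le hB))
  have hm : Measurable fun t : ℝ => ∑' k : ℤ, A.indicator (fun _ => (1 : ENNReal)) (t + k) :=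
    Measurable.tsum fun k =>
      (measurable_const.indicator hA).comp (measurable_add_const _)
  rw [← lintegral_add_left hm]
  have hN : N = ∫⁻ _ in Set.Ico (0 : ℝ) 1, N := by simp
  rw [hN]
  refine lintegral_mono_ae ((ae_restrict_iff' measurableSet_Ico).2 ?_)
  simpa only [tsum_indicator_int_translates] using h

/-! ### The lower bound on the supports -/

/-- `N` vectors with fewer than `N` coordinates satisfy a nontrivial linear relation. -/
theorem exists_relation_of_card_lt {ι : Type*} [Fintype ι] {N : ℕ} (hι : Fintype.card ι < N)
    (M : Fin N → ι → ℂ) : ∃ w : Fin N → ℂ, w ≠ 0 ∧ ∀ i, ∑ n, w n * M n i = 0 := by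
  have h := LinearMap.ker_ne_bot_of_finrank_lt (f := Matrix.vecMulLinear (R := ℂ) (Matrix.of M))
    (by simpa using hι)
  obtain ⟨w, hw, hw0⟩ := (Submodule.ne_bot_iff _).1 h
  refine ⟨w, hw0, fun i => ?_⟩
  simpa [Matrix.vecMul, dotProduct] using congrFun (LinearMap.mem_ker.1 hw) i

/-- The points of `[0, 1)` at which the cubic B-spline has a two-generator expansion involving
a given set of fewer than four shifts form a finite set. -/
theorem finite_of_bspline_three_expansion {φ₁ φ₂ : ℝ → ℂ} {c d : ℤ → ℂ} {S T : Finset ℤ}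
    (hST : S.card + T.card < 4) {E : Set ℝ} (hE : E ⊆ Set.Ico 0 1)
    (h : ∀ t ∈ E, ∀ n : ℕ, (bspline 3 (t + n) : ℂ) =
      ∑ m ∈ S, c (n - m) * φ₁ (t + m) + ∑ m ∈ T, d (n - m) * φ₂ (t + m)) : E.Finite := by
  by_contra hinf
  -- The coefficient matrix is free of `t`, so a single `w` serves all of `E`.
  obtain ⟨w, hw0, hw⟩ := exists_relation_of_card_lt (ι := S ⊕ T) (N := 4) (by simpa using hST)
    (fun n => Sum.elim (fun m => c ((n : ℕ) - m)) (fun m => d ((n : ℕ) - m)))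
  refine hw0 (bspline_three_shifts_linearIndependent hE hinf fun t ht => ?_)
  have h1 : ∀ m ∈ S, ∑ n : Fin 4, w n * c ((n : ℕ) - m) = 0 :=
    fun m hm => hw (Sum.inl ⟨m, hm⟩)
  have h2 : ∀ m ∈ T, ∑ n : Fin 4, w n * d ((n : ℕ) - m) = 0 :=
    fun m hm => hw (Sum.inr ⟨m, hm⟩)
  simp_rw [h t ht, mul_add, Finset.mul_sum, Finset.sum_add_distrib]
  rw [Finset.sum_comm, Finset.sum_comm (t := T)]
  simp_rw [← mul_assoc, ← Finset.sum_mul]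
  rw [Finset.sum_eq_zero fun m hm => by rw [h1 m hm, zero_mul],
    Finset.sum_eq_zero fun m hm => by rw [h2 m hm, zero_mul], add_zero]

/-- Reindexing by `m = n - k` moves the dependence on `n` from the sample points into the
coefficients. -/
theorem hasSum_int_translate {φ₁ φ₂ : ℝ → ℂ} {c d : ℤ → ℂ} {t : ℝ} {n : ℤ} {z : ℂ}
    (h : HasSum (fun k : ℤ => c k * φ₁ (t + n - k) + d k * φ₂ (t + n - k)) z) :
    HasSum (fun m : ℤ => c (n - m) * φ₁ (t + m) + d (n - m) * φ₂ (t + m)) z := by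
  rw [← (Equiv.subLeft n).hasSum_iff] at h
  convert h using 2 with m
  simp [add_sub_assoc]

theorem four_le_volume_essSupport {φ₁ φ₂ : ℝ → ℂ} {c d : ℤ → ℂ}
    (hβ3 : ∀ᵐ t : ℝ, HasSum (fun k : ℤ => c k * φ₁ (t - k) + d k * φ₂ (t - k))
      (bspline 3 t : ℂ)) :
    4 ≤ volume (essSupport φ₁) + volume (essSupport φ₂) := by
  refine le_volume_add_volume_of_encard (measurableSet_essSupport φ₁)
    (measurableSet_essSupport φ₂) ?_
  -- The cardinality condition sits inside `E S T`, so the union may run over all pairs: large ones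
  -- contribute nothing.
  let E : Finset ℤ → Finset ℤ → Set ℝ := fun S T => {t | t ∈ Set.Ico (0 : ℝ) 1 ∧
    S.card + T.card < 4 ∧ ∀ n : ℕ, (bspline 3 (t + n) : ℂ) =
      ∑ m ∈ S, c (n - m) * φ₁ (t + m) + ∑ m ∈ T, d (n - m) * φ₂ (t + m)}
  have hE : ∀ S T, (E S T).Finite := by
    intro S T
    by_cases hST : S.card + T.card < 4
    · exact finite_of_bspline_three_expansion hST (fun t ht => ht.1) fun t ht => ht.2.2
    · exact Set.finite_empty.subset fun t ht => hST ht.2.1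
  have hnull : ∀ᵐ t : ℝ, t ∉ ⋃ S, ⋃ T, E S T :=
    compl_mem_ae_iff.2 ((Set.countable_iUnion fun S => Set.countable_iUnion fun T =>
      (hE S T).countable).measure_zero volume)
  filter_upwards [hnull, ae_forall_add_int hβ3,
    ae_forall_add_int (ae_mem_essSupport_of_ne_zero φ₁),
    ae_forall_add_int (ae_mem_essSupport_of_ne_zero φ₂)] with t ht hsum h1 h2 htI
  by_contra! hlt
  have hfin : ∀ {s : Set ℤ}, (s.encard : ENNReal) < 4 → s.Finite := fun hs => by
    rw [← Set.encard_lt_top_iff]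
    exact_mod_cast hs.trans (by norm_num : (4 : ENNReal) < ⊤)
  have hS := hfin (lt_of_le_of_lt le_self_add hlt)
  have hT := hfin (lt_of_le_of_lt le_add_self hlt)
  refine ht (Set.mem_iUnion₂.2 ⟨hS.toFinset, hT.toFinset, htI, ?_, fun n => ?_⟩)
  · rw [hS.encard_eq_coe_toFinset_card, hT.encard_eq_coe_toFinset_card] at hlt
    exact_mod_cast hlt
  · classical
    have hs := hasSum_int_translate (hsum n)
    rw [Int.cast_natCast] at hs
    refine (hs.unique (hasSum_sum_of_ne_finset_zero (s := hS.toFinset ∪ hT.toFinset) ?_)).trans ?_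
    · intro m hm
      simp only [Finset.mem_union, Set.Finite.mem_toFinset, Set.mem_ofPred_eq, not_or] at hm
      rw [not_imp_comm.1 (h1 m) hm.1, not_imp_comm.1 (h2 m) hm.2, mul_zero, mul_zero, add_zero]
    · rw [Finset.sum_add_distrib]
      congr 1
      · refine (Finset.sum_subset Finset.subset_union_left fun m _ hm => ?_).symm
        rw [Set.Finite.mem_toFinset] at hm
        rw [not_imp_comm.1 (h1 m) hm, mul_zero]
      · refine (Finset.sum_subset Finset.subset_union_right fun m _ hm => ?_).symm
        rw [Set.Finite.mem_toFinset] at hm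
        rw [not_imp_comm.1 (h2 m) hm, mul_zero]

/-! ### Membership in the shift-invariant space -/

/-- The almost everywhere sum of integer translates of two `L²` functions, with absolutely
summable coefficients, belongs to their shift-invariant space. -/
theorem mem_shiftInvariantSpace_of_ae_hasSum {φ₁ φ₂ f : ℝ → ℂ} (hφ₁ : MemLp φ₁ 2 volume)
    (hφ₂ : MemLp φ₂ 2 volume) {a b : ℤ → ℂ} (ha : Summable fun k => ‖a k‖)
    (hb : Summable fun k => ‖b k‖)
    (hf : ∀ᵐ t : ℝ, HasSum (fun k : ℤ => a k * φ₁ (t - k) + b k * φ₂ (t - k)) (f t)) :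
    f ∈ shiftInvariantSpace ![φ₁, φ₂] := by
  have hshift : ∀ {φ : ℝ → ℂ}, MemLp φ 2 volume → ∀ k : ℤ,
      MemLp (fun t => φ (t - k)) 2 volume := fun hφ k =>
    hφ.comp_measurePreserving (measurePreserving_sub_right volume (k : ℝ))
  have hnorm : ∀ {φ : ℝ → ℂ} (hφ : MemLp φ 2 volume) (k : ℤ),
      ‖(hshift hφ k).toLp‖ = ‖hφ.toLp‖ := fun hφ k => by
    rw [Lp.norm_toLp, Lp.norm_toLp]
    exact congrArg ENNReal.toReal
      (eLpNorm_comp_measurePreserving hφ.1 (measurePreserving_sub_right volume (k : ℝ)))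
  have hterm : ∀ k : ℤ, MemLp (fun t => a k * φ₁ (t - k) + b k * φ₂ (t - k)) 2 volume :=
    fun k => ((hshift hφ₁ k).const_mul (a k)).add ((hshift hφ₂ k).const_mul (b k))
  let F : ℤ → Lp ℂ 2 (volume : Measure ℝ) := fun k => (hterm k).toLp
  have hFk : ∀ k, F k = a k • (hshift hφ₁ k).toLp + b k • (hshift hφ₂ k).toLp := fun k => rfl
  have hF : Summable fun k => ‖F k‖ := by
    refine Summable.of_nonneg_of_le (fun _ => norm_nonneg _) (fun k => ?_)
      ((ha.mul_right ‖hφ₁.toLp‖).add (hb.mul_right ‖hφ₂.toLp‖))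
    rw [hFk]
    refine (norm_add_le _ _).trans_eq ?_
    rw [norm_smul, norm_smul, hnorm, hnorm]
  have hFe : ∑' k, ‖F k‖ₑ ≠ ⊤ := by
    simpa [enorm_eq_nnnorm] using ENNReal.tsum_coe_ne_top_iff_summable.2
      (NNReal.summable_coe.1 (by simpa using hF))
  -- Absolute convergence in `L²` also gives pointwise convergence almost everywhere, which
  -- identifies the `L²` sum with `f`.
  have hlim : (⇑(∑' k, F k) : ℝ → ℂ) =ᵐ[volume] f := by
    filter_upwards [Lp.hasSum_coeFn_tsum hFe, ae_all_iff.2 fun k => (hterm k).coeFn_toLp, hf]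
      with t h1 h2 h3
    exact h1.unique (by simpa only [F, h2] using h3)
  have hfm : MemLp f 2 volume := (memLp_congr_ae hlim).1 (Lp.memLp _)
  have hsq : ∀ {u : ℤ → ℂ}, (Summable fun k => ‖u k‖) → Summable fun k => ‖u k‖ ^ 2 := by
    intro u hu
    -- All but finitely many terms have norm at most `1`, where squaring does not increase them.
    refine Summable.of_norm_bounded_eventually hu ?_
    filter_upwards [hu.tendsto_cofinite_zero.eventually_le_const zero_lt_one] with k hk
    rw [norm_pow, norm_norm]
    exact pow_le_of_le_one (norm_nonneg _) hk two_ne_zero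
  refine ⟨hfm, ![a, b], fun i => ?_, ?_⟩
  · fin_cases i
    · exact hsq ha
    · exact hsq hb
  · have ht := (Lp.tendsto_Lp_iff_tendsto_eLpNorm' _ _).1 hF.of_norm.hasSum
    refine ht.congr fun s => ?_
    rw [eLpNorm_sub_comm]
    refine eLpNorm_congr_ae ?_
    filter_upwards [hlim, Lp.coeFn_fun_finsetSum s F,
      ae_all_iff.2 fun k => (hterm k).coeFn_toLp] with t h1 h2 h3
    simp only [Pi.sub_apply, h1, h2, F, h3, Fin.sum_univ_two, Finset.sum_add_distrib,
      Matrix.cons_val_zero, Matrix.cons_val_one]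

/-- A sequence with a summable weighted norm, whose weights are at least `1` off the origin, is
absolutely summable. -/
theorem summable_norm_of_summable_abs_pow_mul {u : ℤ → ℂ} {v : ℤ → ℝ} (huv : ∀ k, ‖u k‖ ≤ v k)
    (h : Summable fun k : ℤ => |(k : ℝ)| ^ 3 * v k) : Summable fun k => ‖u k‖ := by
  refine Summable.of_norm_bounded_eventually h ?_
  filter_upwards [(Set.finite_singleton (0 : ℤ)).compl_mem_cofinite] with k hk
  have h1 : (1 : ℝ) ≤ |(k : ℝ)| := by exact_mod_cast Int.one_le_abs hk
  rw [norm_norm]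
  exact (huv k).trans (le_mul_of_one_le_left ((norm_nonneg _).trans (huv k)) (one_le_pow₀ h1))

theorem theorem1 (φ₁ φ₂ : ℝ → ℂ) (hφ₁ : MemLp φ₁ 2 volume) (hφ₂ : MemLp φ₂ 2 volume)
    (a b c d : ℤ → ℂ)
    (hβ2 : ∀ᵐ t : ℝ, HasSum (fun k : ℤ => a k * φ₁ (t - k) + b k * φ₂ (t - k))
      (bspline 2 t : ℂ))
    (hβ3 : ∀ᵐ t : ℝ, HasSum (fun k : ℤ => c k * φ₁ (t - k) + d k * φ₂ (t - k))
      (bspline 3 t : ℂ))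
    (hsum : Summable fun k : ℤ => |(k : ℝ)| ^ 3 * (‖a k‖ + ‖b k‖ + ‖c k‖ + ‖d k‖)) :
    (fun t : ℝ => (bspline 2 t : ℂ)) ∈ shiftInvariantSpace ![φ₁, φ₂] ∧
    (fun t : ℝ => (bspline 3 t : ℂ)) ∈ shiftInvariantSpace ![φ₁, φ₂] ∧
    4 ≤ volume (essSupport φ₁) + volume (essSupport φ₂) := by
  have hs : ∀ {u : ℤ → ℂ}, (∀ k, ‖u k‖ ≤ ‖a k‖ + ‖b k‖ + ‖c k‖ + ‖d k‖) →
      Summable fun k => ‖u k‖ := fun h => summable_norm_of_summable_abs_pow_mul h hsum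
  refine ⟨mem_shiftInvariantSpace_of_ae_hasSum hφ₁ hφ₂ (hs fun k => ?_) (hs fun k => ?_) hβ2,
    mem_shiftInvariantSpace_of_ae_hasSum hφ₁ hφ₂ (hs fun k => ?_) (hs fun k => ?_) hβ3,
    four_le_volume_essSupport hβ3⟩
  all_goals linarith [norm_nonneg (a k), norm_nonneg (b k), norm_nonneg (c k), norm_nonneg (d k)]
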